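/- A monotone circuit is a Boolean circuit (a directed acyclic graph) built from AND and OR gates of fan-in two, without negations, whose inputs are the input variables and the constants $0,1$; its size is its number of AND and OR gates. For integers $n,k$, let $k\text{-}\mathsf{CLIQUE}:\{0,1\}^{\binom n2}\to\{0,1\}$ be the function that takes a graph on $n$ labelled vertices (one Boolean variable for each of the $\binom n2$ potential edges) and outputs $1$ if and only if the graph contains a clique on $k$ vertices. Theorem. Let $\delta\in(0,1/3)$ be a real number. There are a real number $c>0$ and an integer $N$, depending only on $\delta$, such that for every $n\ge N$, with $k=\lfloor n^{1/3-\delta}\rfloor$, every monotone circuit computing $k\text{-}\mathsf{CLIQUE}$ on $n$-vertex graphs has size at least $c\,n^{\delta^2k/2}$. That is, the monotone circuit size of $k\text{-}\mathsf{CLIQUE}$ is $\Omega(n^{\delta^2k/2})$ as $n\to\infty$. -/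

import Mathlib

/-- What a wire may carry when `m` gates are already available: an input variable,
a Boolean constant, or the output of one of these gates. -/
inductive MonoSource (V : Type) (m : ℕ) : Type
  | input (v : V) : MonoSource V m
  | const (b : Bool) : MonoSource V m
  | gate (j : Fin m) : MonoSource V m

/-- The value carried by a wire, given the input and the values of the earlier gates. -/
def MonoSource.eval {V : Type} {m : ℕ} (x : V → Bool) (val : Fin m → Bool) :
    MonoSource V m → Bool
  | .input v => x v
  | .const b => b
  | .gate j => val j

/-- A gate of fan-in two, an AND gate or an OR gate. -/
inductive MonoGate (V : Type) (m : ℕ) : Type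
  | and (a b : MonoSource V m) : MonoGate V m
  | or (a b : MonoSource V m) : MonoGate V m

/-- The value of a gate, given the input and the values of the earlier gates. -/
def MonoGate.eval {V : Type} {m : ℕ} (x : V → Bool) (val : Fin m → Bool) :
    MonoGate V m → Bool
  | .and a b => a.eval x val && b.eval x val
  | .or a b => a.eval x val || b.eval x val

/-- A topologically ordered list of `m` gates, each of which reads input variables, constants
and earlier gates only. A gate may be read any number of times (unbounded fan-out). -/
inductive MonoGates (V : Type) : ℕ → Type
  | nil : MonoGates V 0
  | snoc {m : ℕ} (P : MonoGates V m) (g : MonoGate V m) : MonoGates V (m + 1)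

/-- The values of all gates on the input `x`. -/
def MonoGates.values {V : Type} (x : V → Bool) : {m : ℕ} → MonoGates V m → Fin m → Bool
  | _, .nil => Fin.elim0
  | _, .snoc P g => Fin.snoc (P.values x) (g.eval x (P.values x))

/-- A monotone Boolean circuit over the input variables `V`: a directed acyclic graph of AND and
OR gates of fan-in two, without negations. Its size is its number of gates; input variables
and constants are not counted. -/
structure MonotoneCircuit (V : Type) : Type where
  size : ℕ
  gates : MonoGates V size
  output : MonoSource V size

/-- The Boolean function computed by a monotone circuit. -/
def MonotoneCircuit.eval {V : Type} (C : MonotoneCircuit V) (x : V → Bool) : Bool :=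
  C.output.eval x (C.gates.values x)

/-- The circuit `C` computes the Boolean function `f`. -/
def MonotoneCircuit.Computes {V : Type} (C : MonotoneCircuit V) (f : (V → Bool) → Bool) : Prop :=
  ∀ x, C.eval x = f x

/-- The `n.choose 2` potential edges of a graph on the vertex set `Fin n`. -/
abbrev PotentialEdge (n : ℕ) : Type := {e : Sym2 (Fin n) // ¬ e.IsDiag}

/-- The graph on `Fin n` whose edges are those `e` with `x e = true`. -/
def graphOfInput {n : ℕ} (x : PotentialEdge n → Bool) : SimpleGraph (Fin n) :=
  SimpleGraph.fromEdgeSet {e | ∃ h : ¬ e.IsDiag, x ⟨e, h⟩ = true}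

open Classical in
/-- The Boolean function `k`-CLIQUE on `n`-vertex graphs: it accepts a graph if and only if the
graph contains `k` pairwise adjacent vertices. -/
noncomputable def kClique (n k : ℕ) (x : PotentialEdge n → Bool) : Bool :=
  decide (∃ s : Finset (Fin n), (graphOfInput x).IsNClique k s)

/-!
The proof is Razborov's method of approximations, with robust "clique-sunflowers" in place of
sunflowers.

Every wire of a monotone circuit for `k`-CLIQUE is approximated by a family of vertex sets of size
at most `t ≈ δ k / 2`, where a family accepts a graph if one of its members is a clique of the graph.
At a gate the two families are combined by union or by pairwise union, and the result is replaced
by a closed family of sets of size at most `c ≈ δ k`, from which all sets with more than `t`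
vertices are then dropped (`exists_trimmed_closure`). The circuit is tested on two distributions.

* Negative tests are random graphs with edge probability `p = n ^ (-2 / (k - 1))`, which have no
  `k`-clique with probability at least `1 / 2`. A family is closed if it contains every small set
  `Y` for which it accepts `G ∪ K_Y` with probability close to `1`, so that closing it changes almost no answer
  (`exists_cliqueClosed_extension`).
* Positive tests are uniformly random `k`-cliques. Dropping large sets loses only cliques that
  contain a minimal member with more than `t` vertices. A closed family has few minimal members of
  each size `a` (`card_minimalSets_le`), so few that a random `k`-set contains one of them with
  probability at most `n ^ (-(3 * δ / 2) * a)`; this is where `k ^ 3 ≤ n ^ (1 - 3 * δ)` is used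
  (`minimal_sets_bound`).

The family of the output accepts either every graph or very few `k`-cliques, so the errors at the
gates must add up to at least one half for one of the two distributions, which forces many gates.

The count of minimal members rests on `exists_clique_sunflower`: among too many sets of size `a`
there are some that share a core `B` and whose remaining edges are so spread out that a random graph
is very likely to contain the missing edges of one of them. Spread is turned into high
probability by a Janson-type inequality, `prob_avoid_le_exp`, which has an elementary proof: greedily
select a subfamily with small mutual correlations, each member of which lowers the probability
of avoiding all of them by a constant fraction of its own probability.
-/

/-! ### Random subsets of a finite set -/

section RandomSubset

variable {E : Type*} [Fintype E]

/-- The probability that a random subset of `E`, containing each element independently with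
probability `p`, equals `G`. -/
noncomputable def subsetWeight (p : ℝ) (G : Finset E) : ℝ :=
  p ^ G.card * (1 - p) ^ (Fintype.card E - G.card)

/-- The expectation of `f G` over a random subset `G` that contains each element independently
with probability `p`. -/
noncomputable def expect (p : ℝ) (f : Finset E → ℝ) : ℝ :=
  ∑ G, subsetWeight p G * f G

open Classical in
/-- The probability that a random subset, containing each element independently with
probability `p`, satisfies `Q`. -/
noncomputable def prob (p : ℝ) (Q : Finset E → Prop) : ℝ :=
  expect p fun G => if Q G then 1 else 0

lemma subsetWeight_nonneg {p : ℝ} (h0 : 0 ≤ p) (h1 : p ≤ 1) (G : Finset E) :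
    0 ≤ subsetWeight p G :=
  mul_nonneg (pow_nonneg h0 _) (pow_nonneg (sub_nonneg.2 h1) _)

lemma expect_mono {p : ℝ} (h0 : 0 ≤ p) (h1 : p ≤ 1) {f g : Finset E → ℝ} (h : ∀ G, f G ≤ g G) :
    expect p f ≤ expect p g :=
  Finset.sum_le_sum fun G _ => mul_le_mul_of_nonneg_left (h G) (subsetWeight_nonneg h0 h1 G)

lemma expect_add (p : ℝ) (f g : Finset E → ℝ) :
    expect p (fun G => f G + g G) = expect p f + expect p g := by
  simp [expect, mul_add, Finset.sum_add_distrib]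

lemma expect_sub (p : ℝ) (f g : Finset E → ℝ) :
    expect p (fun G => f G - g G) = expect p f - expect p g := by
  simp [expect, mul_sub, Finset.sum_sub_distrib]

lemma expect_sum {ι : Type*} (p : ℝ) (s : Finset ι) (f : ι → Finset E → ℝ) :
    expect p (fun G => ∑ i ∈ s, f i G) = ∑ i ∈ s, expect p (f i) := by
  simp only [expect, Finset.mul_sum]
  exact Finset.sum_comm

lemma expect_one (p : ℝ) : expect (E := E) p (fun _ => 1) = 1 := by
  simp [expect, subsetWeight, Fintype.sum_pow_mul_eq_add_pow]

lemma prob_mono {p : ℝ} (h0 : 0 ≤ p) (h1 : p ≤ 1) {Q R : Finset E → Prop} (h : ∀ G, Q G → R G) :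
    prob p Q ≤ prob p R := by
  refine expect_mono h0 h1 fun G => ?_
  by_cases hQ : Q G
  · simp [hQ, h G hQ]
  · simp only [hQ, if_false]; split_ifs <;> norm_num

lemma prob_nonneg {p : ℝ} (h0 : 0 ≤ p) (h1 : p ≤ 1) (Q : Finset E → Prop) : 0 ≤ prob p Q :=
  Finset.sum_nonneg fun G _ => mul_nonneg (subsetWeight_nonneg h0 h1 G) (by dsimp only; split_ifs <;> norm_num)

lemma prob_true (p : ℝ) : prob (E := E) p (fun _ => True) = 1 := by
  simp [prob, expect_one]

lemma prob_false (p : ℝ) : prob (E := E) p (fun _ => False) = 0 := by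
  simp [prob, expect]

lemma prob_or_le {p : ℝ} (h0 : 0 ≤ p) (h1 : p ≤ 1) (Q R : Finset E → Prop) :
    prob p (fun G => Q G ∨ R G) ≤ prob p Q + prob p R := by
  unfold prob
  rw [← expect_add]
  refine expect_mono h0 h1 fun G => ?_
  by_cases hQ : Q G <;> by_cases hR : R G <;> simp [hQ, hR]

lemma prob_exists_le {ι : Type*} {p : ℝ} (h0 : 0 ≤ p) (h1 : p ≤ 1) (s : Finset ι)
    (Q : ι → Finset E → Prop) :
    prob p (fun G => ∃ i ∈ s, Q i G) ≤ ∑ i ∈ s, prob p (Q i) := by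
  classical
  induction s using Finset.induction_on with
  | empty => simp [prob_false]
  | insert a s ha ih =>
    rw [Finset.sum_insert ha]
    refine le_trans (prob_mono h0 h1 ?_)
      ((prob_or_le h0 h1 (Q a) (fun G => ∃ i ∈ s, Q i G)).trans (by gcongr))
    rintro G ⟨i, hi, h⟩
    rcases Finset.mem_insert.1 hi with rfl | hi
    · exact Or.inl h
    · exact Or.inr ⟨i, hi, h⟩

variable [DecidableEq E]

lemma subsetWeight_insert (p : ℝ) {e : E} {G : Finset E} (he : e ∉ G) :
    (1 - p) * subsetWeight p (insert e G) = p * subsetWeight p G := by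
  have hlt : G.card < Fintype.card E := by
    rw [← Finset.card_univ]
    exact Finset.card_lt_card ⟨Finset.subset_univ _, fun h => he (h (Finset.mem_univ e))⟩
  have : Fintype.card E - G.card = (Fintype.card E - (G.card + 1)) + 1 := by omega
  rw [subsetWeight, subsetWeight, Finset.card_insert_of_notMem he, this]
  ring

lemma expect_ite_mem (p : ℝ) (e : E) (f : Finset E → ℝ) :
    expect p (fun G => if e ∈ G then f G else 0) = p * expect p (fun G => f (insert e G)) := by
  have key : ∑ G with e ∉ G, subsetWeight p (insert e G) * f (insert e G)
      = ∑ G with e ∈ G, subsetWeight p G * f G := by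
    refine Finset.sum_bij' (fun G _ => insert e G) (fun G _ => G.erase e) ?_ ?_ ?_ ?_ ?_
    · simp
    · simp
    · intro G hG
      exact Finset.erase_insert (by simpa using hG)
    · intro G hG
      exact Finset.insert_erase (by simpa using hG)
    · simp
  have split : ∀ g : Finset E → ℝ, ∑ G, g G = ∑ G with e ∈ G, g G + ∑ G with e ∉ G, g G :=
    fun g => (Finset.sum_filter_add_sum_filter_not _ _ _).symm
  have hin : ∑ G with e ∈ G, subsetWeight p G * f (insert e G)
      = ∑ G with e ∈ G, subsetWeight p G * f G := by
    refine Finset.sum_congr rfl fun G hG => ?_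
    rw [Finset.insert_eq_of_mem (by simpa using hG)]
  have hout : p * ∑ G with e ∉ G, subsetWeight p G * f (insert e G)
      = (1 - p) * ∑ G with e ∈ G, subsetWeight p G * f G := by
    rw [← key, Finset.mul_sum, Finset.mul_sum]
    refine Finset.sum_congr rfl fun G hG => ?_
    rw [← mul_assoc, ← mul_assoc, subsetWeight_insert p (by simpa using hG)]
  have hL : expect p (fun G => if e ∈ G then f G else 0)
      = ∑ G with e ∈ G, subsetWeight p G * f G := by
    simp [expect, Finset.sum_filter]
  rw [hL, expect, split, mul_add, hin, hout]
  ring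

/-- Conditioning on `U ⊆ G` amounts to replacing `G` by `G ∪ U`. Every independence and
correlation statement used below is an instance of this identity. -/
lemma expect_ite_subset (p : ℝ) (U : Finset E) (f : Finset E → ℝ) :
    expect p (fun G => if U ⊆ G then f G else 0) = p ^ U.card * expect p (fun G => f (G ∪ U)) := by
  induction U using Finset.induction_on generalizing f with
  | empty => simp
  | insert e U he ih =>
    have h1 : ∀ G, (if insert e U ⊆ G then f G else 0)
        = if e ∈ G then (if U ⊆ G then f G else 0) else 0 := by
      intro G
      by_cases h : e ∈ G <;> by_cases h' : U ⊆ G <;> simp [Finset.insert_subset_iff, h, h']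
    have h2 : ∀ G, (if U ⊆ insert e G then f (insert e G) else 0)
        = if U ⊆ G then f (insert e G) else 0 := by
      intro G
      simp only [Finset.subset_insert_iff_of_notMem he]
    simp only [h1]
    rw [expect_ite_mem p e (fun G => if U ⊆ G then f G else 0)]
    simp only [h2]
    rw [ih (fun G => f (insert e G)), Finset.card_insert_of_notMem he, pow_succ']
    simp [mul_assoc]

lemma prob_subset (p : ℝ) (U : Finset E) : prob p (fun G => U ⊆ G) = p ^ U.card := by
  classical
  have := expect_ite_subset p U (fun _ => 1)
  rw [expect_one, mul_one] at this
  rw [← this, prob]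
  congr!

/-! ### A Janson-type inequality -/

/-- One step of the Boppana–Spencer argument: if the total correlation of `U i` with the sets
indexed by `I` is at most half of the probability `q` of `U i ⊆ G`, then requiring `U i ⊈ G` in
addition lowers the probability of avoiding `I` by a factor `1 - q / 2`. -/
lemma prob_avoid_insert_le {ι : Type*} [DecidableEq ι] {p : ℝ} (h0 : 0 ≤ p) (h1 : p ≤ 1)
    (U : ι → Finset E) {q : ℝ} (i : ι) (I : Finset ι) (hq : p ^ (U i).card = q) (hq0 : 0 ≤ q)
    (hI : ∑ j ∈ I with ¬ Disjoint (U i) (U j), p ^ (U i ∪ U j).card ≤ q / 2) :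
    prob p (fun G => ∀ j ∈ insert i I, ¬ U j ⊆ G) ≤
      (1 - q / 2) * prob p (fun G => ∀ j ∈ I, ¬ U j ⊆ G) := by
  classical
  set J₀ := I.filter fun j => Disjoint (U i) (U j) with hJ₀
  set J₁ := I.filter fun j => ¬ Disjoint (U i) (U j) with hJ₁
  let a : Finset E → ℝ := fun G => if ∀ j ∈ J₀, ¬ U j ⊆ G then 1 else 0
  have ha0 : ∀ G, 0 ≤ a G := fun G => by simp only [a]; split_ifs <;> norm_num
  have hP0 : expect p a = prob p (fun G => ∀ j ∈ J₀, ¬ U j ⊆ G) := by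
    unfold prob
    congr!
  have hle : prob p (fun G => ∀ j ∈ I, ¬ U j ⊆ G) ≤ expect p a := by
    rw [hP0]
    exact prob_mono h0 h1 fun G h j hj => h j (Finset.mem_filter.1 hj).1
  have hdisj : ∀ G, a (G ∪ U i) = a G := by
    intro G
    have : (∀ j ∈ J₀, ¬ U j ⊆ G ∪ U i) ↔ ∀ j ∈ J₀, ¬ U j ⊆ G := by
      refine forall₂_congr fun j hj => not_congr ⟨fun h => ?_, fun h => h.trans (by simp)⟩
      exact (Finset.mem_filter.1 hj).2.symm.left_le_of_le_sup_right h
    simp only [a, this]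
  have hanti : ∀ G W, a (G ∪ W) ≤ a G := by
    intro G W
    by_cases h : ∀ j ∈ J₀, ¬ U j ⊆ G ∪ W
    · have h' : ∀ j ∈ J₀, ¬ U j ⊆ G := fun j hj hs => h j hj (hs.trans (by simp))
      simp only [a, if_pos h, if_pos h', le_refl]
    · simp only [a, if_neg h]; exact ha0 G
  have hpt : ∀ G, (if ∀ j ∈ insert i I, ¬ U j ⊆ G then (1 : ℝ) else 0) ≤
      (if ∀ j ∈ I, ¬ U j ⊆ G then 1 else 0) - (if U i ⊆ G then a G else 0)
        + ∑ j ∈ J₁, (if U i ∪ U j ⊆ G then a G else 0) := by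
    intro G
    have hsum : 0 ≤ ∑ j ∈ J₁, (if U i ∪ U j ⊆ G then a G else 0) :=
      Finset.sum_nonneg fun j _ => by split_ifs; exacts [ha0 G, le_rfl]
    have ha1 : a G ≤ 1 := by simp only [a]; split_ifs <;> norm_num
    by_cases hA : ∀ j ∈ I, ¬ U j ⊆ G
    · by_cases hi : U i ⊆ G
      · rw [if_neg (by simp [hi]), if_pos hA, if_pos hi]
        linarith
      · rw [if_pos hA, if_neg hi]
        split_ifs <;> linarith
    · rw [if_neg (fun h => hA fun j hj => h j (Finset.mem_insert_of_mem hj)), if_neg hA]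
      by_cases hi : U i ⊆ G
      · rw [if_pos hi]
        by_cases hJ : ∀ j ∈ J₀, ¬ U j ⊆ G
        · obtain ⟨j, hj, hjG⟩ : ∃ j ∈ I, U j ⊆ G := by simpa using hA
          have hj1 : j ∈ J₁ := Finset.mem_filter.2
            ⟨hj, fun hd => hJ j (Finset.mem_filter.2 ⟨hj, hd⟩) hjG⟩
          have := Finset.single_le_sum (f := fun j => if U i ∪ U j ⊆ G then a G else 0)
            (fun j _ => by split_ifs; exacts [ha0 G, le_rfl]) hj1
          simp only [if_pos (Finset.union_subset hi hjG)] at this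
          linarith
        · have : a G = 0 := by simp only [a, if_neg hJ]
          linarith
      · rw [if_neg hi]
        linarith
  have hmain := expect_mono h0 h1 hpt
  rw [expect_add, expect_sub, expect_sum, expect_ite_subset] at hmain
  simp only [hdisj, hq] at hmain
  have hcorr : ∑ j ∈ J₁, expect p (fun G => if U i ∪ U j ⊆ G then a G else 0)
      ≤ (q / 2) * expect p a := by
    refine le_trans (Finset.sum_le_sum fun j _ => ?_)
      ((Finset.sum_mul J₁ (fun j => p ^ (U i ∪ U j).card) (expect p a)).symm.le.trans ?_)
    · rw [expect_ite_subset]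
      exact mul_le_mul_of_nonneg_left (expect_mono h0 h1 fun G => hanti G _) (pow_nonneg h0 _)
    · refine mul_le_mul_of_nonneg_right hI ?_
      rw [hP0]
      exact prob_nonneg h0 h1 _
  have : (q / 2) * prob p (fun G => ∀ j ∈ I, ¬ U j ⊆ G) ≤ (q / 2) * expect p a :=
    mul_le_mul_of_nonneg_left hle (by linarith)
  have e₁ : expect p (fun G => if ∀ j ∈ insert i I, ¬ U j ⊆ G then (1 : ℝ) else 0)
      = prob p (fun G => ∀ j ∈ insert i I, ¬ U j ⊆ G) := by unfold prob; congr!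
  have e₂ : expect p (fun G => if ∀ j ∈ I, ¬ U j ⊆ G then (1 : ℝ) else 0)
      = prob p (fun G => ∀ j ∈ I, ¬ U j ⊆ G) := by unfold prob; congr!
  rw [e₁, e₂] at hmain
  linarith

/-- A Janson-type inequality for sets `U i` that are all contained in the random set with the same
probability `q`: if the correlations `∑ j, P(U i ∪ U j ⊆ G)`, over `j` with `U j` meeting `U i`, are
bounded by `q * D`, then the probability that no `U i` is contained in the random set is
exponentially small in `q * |S| / D`. -/
theorem prob_avoid_le_exp {ι : Type*} [DecidableEq ι] {p : ℝ} (h0 : 0 ≤ p) (h1 : p ≤ 1)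
    (U : ι → Finset E) {q D : ℝ} (S : Finset ι) (hq : ∀ i ∈ S, p ^ (U i).card = q) (hq0 : 0 < q)
    (hq1 : q ≤ 1) (hD0 : 0 ≤ D)
    (hD : ∀ i ∈ S, ∑ j ∈ S with ¬ Disjoint (U i) (U j), p ^ (U i ∪ U j).card ≤ q * D) :
    prob p (fun G => ∀ i ∈ S, ¬ U i ⊆ G) ≤ Real.exp (-(q * S.card / (2 * (1 + 2 * D)))) := by
  classical
  -- A subfamily of maximal size among those for which the greedy bound `(1 - q / 2) ^ |I|` holds.
  obtain ⟨I, hI, hmax⟩ := Finset.exists_max_image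
    (S.powerset.filter fun I => prob p (fun G => ∀ i ∈ I, ¬ U i ⊆ G) ≤ (1 - q / 2) ^ I.card)
    Finset.card ⟨∅, by simp [prob_true]⟩
  simp only [Finset.mem_filter, Finset.mem_powerset] at hI hmax
  obtain ⟨hIS, hIP⟩ := hI
  -- By maximality, every other set is strongly correlated with the subfamily.
  have hout : ∀ i ∈ S \ I, q / 2 ≤ ∑ j ∈ I with ¬ Disjoint (U i) (U j), p ^ (U i ∪ U j).card := by
    intro i hi
    rw [Finset.mem_sdiff] at hi
    by_contra! hlt
    have hstep := prob_avoid_insert_le h0 h1 U i I (hq i hi.1) hq0.le hlt.le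
    have := hmax (insert i I) ⟨Finset.insert_subset hi.1 hIS, by
      rw [Finset.card_insert_of_notMem hi.2, pow_succ']
      exact hstep.trans (mul_le_mul_of_nonneg_left hIP (by linarith))⟩
    rw [Finset.card_insert_of_notMem hi.2] at this
    omega
  have hcount : ((S \ I).card : ℝ) * (q / 2) ≤ I.card * (q * D) := by
    calc ((S \ I).card : ℝ) * (q / 2) = ∑ i ∈ S \ I, q / 2 := by simp
      _ ≤ ∑ i ∈ S \ I, ∑ j ∈ I with ¬ Disjoint (U i) (U j), p ^ (U i ∪ U j).card :=
        Finset.sum_le_sum hout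
      _ = ∑ j ∈ I, ∑ i ∈ S \ I with ¬ Disjoint (U j) (U i), p ^ (U j ∪ U i).card := by
        simp only [Finset.sum_filter]
        rw [Finset.sum_comm]
        simp only [disjoint_comm, Finset.union_comm]
      _ ≤ ∑ j ∈ I, q * D := by
        refine Finset.sum_le_sum fun j hj => le_trans ?_ (hD j (hIS hj))
        refine Finset.sum_le_sum_of_subset_of_nonneg ?_ fun _ _ _ => pow_nonneg h0 _
        exact Finset.filter_subset_filter _ Finset.sdiff_subset
      _ = _ := by simp
  have hcard : ((S \ I).card : ℝ) = S.card - I.card := by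
    rw [Finset.card_sdiff_of_subset hIS, Nat.cast_sub (Finset.card_le_card hIS)]
  have hIbig : (S.card : ℝ) ≤ (1 + 2 * D) * I.card := by
    rw [hcard] at hcount
    have : q * ((S.card : ℝ) - I.card) ≤ q * (2 * D * I.card) := by linarith
    have := le_of_mul_le_mul_left this hq0
    linarith
  calc prob p (fun G => ∀ i ∈ S, ¬ U i ⊆ G) ≤ prob p (fun G => ∀ i ∈ I, ¬ U i ⊆ G) :=
        prob_mono h0 h1 fun G h i hi => h i (hIS hi)
    _ ≤ (1 - q / 2) ^ I.card := hIP
    _ ≤ (Real.exp (-(q / 2))) ^ I.card := by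
        refine pow_le_pow_left₀ (by linarith) ?_ _
        have := Real.add_one_le_exp (-(q / 2))
        linarith
    _ = Real.exp (-(q / 2 * I.card)) := by
        rw [← Real.exp_nat_mul]; ring_nf
    _ ≤ _ := by
        refine Real.exp_le_exp.2 (neg_le_neg ?_)
        rw [div_le_iff₀ (by positivity)]
        have := mul_le_mul_of_nonneg_left hIbig hq0.le
        linarith

end RandomSubset

/-! ### Cliques in a random graph -/

/-- The potential edges with both endpoints in `A`, i.e. the edges of the complete graph
on `A`. -/
def cliqueEdges {n : ℕ} (A : Finset (Fin n)) : Finset (PotentialEdge n) :=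
  A.sym2.subtype fun e => ¬ e.IsDiag

lemma mem_cliqueEdges {n : ℕ} {A : Finset (Fin n)} {e : PotentialEdge n} :
    e ∈ cliqueEdges A ↔ ∀ v ∈ e.1, v ∈ A := by
  simp [cliqueEdges, Finset.mem_sym2_iff]

lemma cliqueEdges_mono {n : ℕ} {A B : Finset (Fin n)} (h : A ⊆ B) :
    cliqueEdges A ⊆ cliqueEdges B :=
  fun _ he => mem_cliqueEdges.2 fun v hv => h (mem_cliqueEdges.1 he v hv)

lemma cliqueEdges_inter {n : ℕ} (A B : Finset (Fin n)) :
    cliqueEdges (A ∩ B) = cliqueEdges A ∩ cliqueEdges B := by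
  ext e
  simp only [mem_cliqueEdges, Finset.mem_inter]
  exact ⟨fun h => ⟨fun v hv => (h v hv).1, fun v hv => (h v hv).2⟩,
    fun h v hv => ⟨h.1 v hv, h.2 v hv⟩⟩

lemma card_cliqueEdges {n : ℕ} (A : Finset (Fin n)) :
    (cliqueEdges A).card = A.card.choose 2 := by
  rw [cliqueEdges, Finset.card_subtype, ← Sym2.card_image_offDiag]
  congr 1
  ext e
  induction e using Sym2.ind with
  | _ a b => simp; aesop

open Finset in
lemma sum_ssubset_pow {α : Type*} [DecidableEq α] (A B : Finset α) (hBA : B ⊆ A) (x : ℝ) :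
    ∑ W ∈ A.powerset with B ⊂ W, x ^ (A.card - W.card)
      = (1 + x) ^ (A.card - B.card) - x ^ (A.card - B.card) := by
  have h := Finset.sum_pow_mul_eq_add_pow (1 : ℝ) x (A \ B)
  rw [card_sdiff_of_subset hBA] at h
  rw [← h, ← Finset.add_sum_erase _ _ (empty_mem_powerset (A \ B))]
  simp only [one_pow, one_mul, card_empty, Nat.sub_zero, add_sub_cancel_left]
  refine Finset.sum_bij' (fun W _ => W \ B) (fun R _ => R ∪ B) ?_ ?_ ?_ ?_ ?_
  · intro W hW
    simp only [mem_filter, mem_powerset] at hW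
    simp only [mem_erase, mem_powerset, ne_eq, sdiff_eq_empty_iff_subset]
    exact ⟨hW.2.2, sdiff_subset_sdiff hW.1 subset_rfl⟩
  · intro R hR
    simp only [mem_erase, mem_powerset, subset_sdiff] at hR
    simp only [mem_filter, mem_powerset]
    refine ⟨union_subset hR.2.1 hBA, subset_union_right, fun hs => hR.1 ?_⟩
    exact disjoint_self.1 (hR.2.2.mono_right (subset_union_left.trans hs))
  · intro W hW
    simp only [mem_filter, mem_powerset] at hW
    exact sdiff_union_of_subset hW.2.1
  · intro R hR
    simp only [mem_erase, mem_powerset, subset_sdiff] at hR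
    rw [union_sdiff_right]
    exact sdiff_eq_self_of_disjoint hR.2.2
  · intro W hW
    simp only [mem_filter, mem_powerset] at hW
    rw [card_sdiff_of_subset hW.2.1]
    congr 1
    have := card_le_card hW.2.1
    have := card_le_card hW.1
    omega

lemma one_add_pow_sub_pow_le {a m : ℕ} {L : ℝ} (hL : 1 ≤ L) (hm : m ≤ a) (ha : 0 < a) :
    (1 + a * L) ^ m - (a * L) ^ m ≤ 2 * (a * L) ^ m / L := by
  have hapos : (0 : ℝ) < a := by exact_mod_cast ha
  have hx : 0 < a * L := by positivity
  have h1 : (1 + a * L) ^ m ≤ (a * L) ^ m * Real.exp (1 / L) := by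
    have : 1 + a * L = (a * L) * (1 / (a * L) + 1) := by field_simp
    rw [this, mul_pow]
    refine mul_le_mul_of_nonneg_left ?_ (by positivity)
    calc (1 / (a * L) + 1) ^ m ≤ (Real.exp (1 / (a * L))) ^ m :=
          pow_le_pow_left₀ (by positivity) (Real.add_one_le_exp _) _
      _ = Real.exp (m * (1 / (a * L))) := (Real.exp_nat_mul _ _).symm
      _ ≤ Real.exp (1 / L) := by
          refine Real.exp_le_exp.2 ?_
          have hma : (m : ℝ) ≤ a := by exact_mod_cast hm
          calc (m : ℝ) * (1 / (a * L)) ≤ a * (1 / (a * L)) := by gcongr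
            _ = 1 / L := by field_simp
  have hL1 : |1 / L| ≤ 1 := by
    rw [abs_of_nonneg (by positivity), div_le_one (by linarith)]; exact hL
  have h2 := (le_abs_self _).trans (Real.abs_exp_sub_one_le hL1)
  rw [abs_of_nonneg (by positivity)] at h2
  calc _ ≤ (a * L) ^ m * (Real.exp (1 / L) - 1) := by linarith
    _ ≤ (a * L) ^ m * (2 * (1 / L)) := by gcongr
    _ = _ := by ring

open Finset in
/-- A large family of `a`-sets contains a clique-sunflower: there is a proper subset `B` of a
member such that, once the edges inside `B` are added to a random graph, some member of the family
is very likely to be a clique. The core `B` is a largest set whose link is still as large as a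
family without concentration would allow. -/
theorem exists_clique_sunflower {n a : ℕ} {p L : ℝ} (hp0 : 0 < p) (hp1 : p ≤ 1) (hL : 1 ≤ L)
    (S : Finset (Finset (Fin n))) (hS : ∀ A ∈ S, A.card = a)
    (hcard : (a * L) ^ a * (p ^ a.choose 2)⁻¹ < S.card) :
    ∃ B, (∃ A ∈ S, B ⊂ A) ∧
      prob p (fun G => ∀ A ∈ S, ¬ cliqueEdges A ⊆ G ∪ cliqueEdges B) ≤ Real.exp (-(L / 10)) := by
  classical
  -- `thr j` bounds the number of members through a set of size `j`; it is `1` at `j = a`.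
  set thr : ℕ → ℝ := fun j => (a * L) ^ (a - j) * (p ^ a.choose 2)⁻¹ * p ^ j.choose 2 with hthr
  let link : Finset (Fin n) → Finset (Finset (Fin n)) := fun B => S.filter fun A => B ⊆ A
  obtain ⟨B, hB, hBmax⟩ := exists_max_image
    (univ.filter fun B : Finset (Fin n) => thr B.card < (link B).card) card
    ⟨∅, by simpa [hthr, link] using hcard⟩
  simp only [mem_filter, mem_univ, true_and] at hB hBmax
  have hBmax' : ∀ W, B ⊂ W → ((link W).card : ℝ) ≤ thr W.card := by
    intro W hW
    by_contra! h
    exact absurd (hBmax W h) (not_le.2 (card_lt_card hW))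
  have hpos : (0 : ℝ) < (link B).card := lt_of_le_of_lt (by positivity) hB
  obtain ⟨A₀, hA₀⟩ : (link B).Nonempty := card_pos.1 (by exact_mod_cast hpos)
  simp only [link, mem_filter] at hA₀
  have hBA₀ : B ≠ A₀ := by
    rintro rfl
    have hsub : link B ⊆ {B} := by
      intro A hA
      simp only [link, mem_filter] at hA
      exact mem_singleton.2 (eq_of_subset_of_card_le hA.2 (by rw [hS A hA.1, hS B hA₀.1])).symm
    have h1 : ((link B).card : ℝ) ≤ 1 := by exact_mod_cast card_le_card hsub
    have h2 : thr B.card = 1 := by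
      simp only [hthr, hS B hA₀.1, Nat.sub_self, pow_zero, one_mul]
      exact inv_mul_cancel₀ (by positivity)
    linarith
  have hss : B ⊂ A₀ := hA₀.2.ssubset_of_ne hBA₀
  refine ⟨B, ⟨A₀, hA₀.1, hss⟩, ?_⟩
  set j := B.card with hj
  have hja : j < a := by rw [← hS A₀ hA₀.1]; exact card_lt_card hss
  have ha : 0 < a := by omega
  have ha1 : (1 : ℝ) ≤ a := by exact_mod_cast ha
  set U : Finset (Fin n) → Finset (PotentialEdge n) := fun A => cliqueEdges A \ cliqueEdges B
    with hU
  set u := a.choose 2 - j.choose 2 with hu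
  have hch : j.choose 2 ≤ a.choose 2 := Nat.choose_le_choose 2 hja.le
  have hUcard : ∀ A ∈ link B, (U A).card = u := by
    intro A hA
    simp only [link, mem_filter] at hA
    rw [hU, card_sdiff_of_subset (cliqueEdges_mono hA.2), card_cliqueEdges, card_cliqueEdges,
      hS A hA.1]
  set T : ℝ := (a * L) ^ (a - j) with hT
  have hTL : L ≤ T := by
    have h1 : (1 : ℝ) ≤ a * L := by nlinarith
    calc L ≤ a * L := by nlinarith
      _ = (a * L) ^ 1 := (pow_one _).symm
      _ ≤ T := pow_le_pow_right₀ h1 (by omega)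
  have hqN : T ≤ p ^ u * (link B).card := by
    have : p ^ u * thr j = T := by
      simp only [hthr, hu]
      rw [pow_sub₀ _ hp0.ne' hch, hT]
      field_simp
    rw [← this]
    exact mul_le_mul_of_nonneg_left hB.le (by positivity)
  have hcorr : ∀ A ∈ link B, ∑ A' ∈ link B with ¬ Disjoint (U A) (U A'),
      p ^ (U A ∪ U A').card ≤ p ^ u * (2 * T / L) := by
    intro A hA
    have hA' := hA
    simp only [link, mem_filter] at hA'
    calc ∑ A' ∈ link B with ¬ Disjoint (U A) (U A'), p ^ (U A ∪ U A').card
        ≤ ∑ W ∈ A.powerset with B ⊂ W, ∑ A' ∈ link B with A ∩ A' = W, p ^ (U A ∪ U A').card := by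
          rw [← sum_fiberwise_of_maps_to (t := A.powerset.filter fun W => B ⊂ W)
            (g := fun A' => A ∩ A')]
          · refine sum_le_sum fun W _ => sum_le_sum_of_subset_of_nonneg ?_
              fun _ _ _ => by positivity
            exact filter_subset_filter _ (filter_subset _ _)
          · intro A' hAA'
            simp only [link, mem_filter] at hAA'
            simp only [mem_filter, mem_powerset]
            refine ⟨inter_subset_left, subset_inter hA'.2 hAA'.1.2, fun hs => hAA'.2 ?_⟩
            rw [disjoint_left]
            intro e he he'
            rw [hU, mem_sdiff] at he he'
            refine he.2 (cliqueEdges_mono hs ?_)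
            rw [cliqueEdges_inter]
            exact mem_inter.2 ⟨he.1, he'.1⟩
      _ ≤ ∑ W ∈ A.powerset with B ⊂ W, p ^ u * (a * L) ^ (A.card - W.card) := by
          refine sum_le_sum fun W hW => ?_
          simp only [mem_filter, mem_powerset] at hW
          have hWa : W.card ≤ a := by rw [← hS A hA'.1]; exact card_le_card hW.1
          have hw1 : j.choose 2 ≤ W.card.choose 2 := Nat.choose_le_choose 2 (card_le_card hW.2.1)
          have hw2 : W.card.choose 2 ≤ a.choose 2 := Nat.choose_le_choose 2 hWa
          have hun : ∀ A' ∈ (link B).filter (fun A' => A ∩ A' = W),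
              p ^ (U A ∪ U A').card = p ^ (u + (a.choose 2 - W.card.choose 2)) := by
            intro A' hA''
            rw [mem_filter] at hA''
            have hint : U A ∩ U A' = cliqueEdges W \ cliqueEdges B := by
              rw [← hA''.2, cliqueEdges_inter]
              ext e
              simp only [hU, mem_inter, mem_sdiff]
              tauto
            rw [card_union, hUcard A hA, hUcard A' hA''.1, hint,
              card_sdiff_of_subset (cliqueEdges_mono hW.2.1), card_cliqueEdges, card_cliqueEdges]
            congr 1
            rw [← hj]
            omega
          rw [sum_congr rfl hun, sum_const, nsmul_eq_mul]
          have hle : (((link B).filter fun A' => A ∩ A' = W).card : ℝ) ≤ thr W.card := by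
            refine le_trans (Nat.cast_le.2 (card_le_card fun A' hA'' => ?_)) (hBmax' W hW.2)
            simp only [link, mem_filter] at hA'' ⊢
            exact ⟨hA''.1.1, by rw [← hA''.2]; exact inter_subset_right⟩
          calc _ ≤ thr W.card * p ^ (u + (a.choose 2 - W.card.choose 2)) := by gcongr
            _ = p ^ u * (a * L) ^ (A.card - W.card) := by
              simp only [hthr, hS A hA'.1]
              rw [pow_add, pow_sub₀ _ hp0.ne' hw2]
              field_simp
      _ = p ^ u * ((1 + a * L) ^ (a - j) - (a * L) ^ (a - j)) := by
          rw [← mul_sum, sum_ssubset_pow _ _ hA'.2, hS A hA'.1]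
      _ ≤ p ^ u * (2 * T / L) := by
          gcongr
          exact one_add_pow_sub_pow_le hL (Nat.sub_le _ _) ha
  have hmain := prob_avoid_le_exp hp0.le hp1 U (q := p ^ u) (D := 2 * T / L) (link B)
    (fun A hA => by rw [hUcard A hA]) (by positivity) (pow_le_one₀ hp0.le hp1) (by positivity) hcorr
  refine (prob_mono hp0.le hp1 fun G h A hA hAG => ?_).trans (hmain.trans ?_)
  · exact h A (mem_filter.1 hA).1 (sdiff_le_iff.1 hAG |>.trans (by rw [sup_comm]; rfl))
  · refine Real.exp_le_exp.2 (neg_le_neg ?_)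
    rw [div_le_div_iff₀ (by norm_num) (by positivity)]
    have h1 : L * (2 * (1 + 2 * (2 * T / L))) = 2 * L + 8 * T := by field_simp; ring
    linarith

/-! ### Closed families of vertex sets -/

/-- A family of vertex sets, read as a monotone function on graphs, accepts a graph if some
member of the family is a clique of the graph. -/
def AcceptsGraph {n : ℕ} (H : Finset (Finset (Fin n))) (G : Finset (PotentialEdge n)) : Prop :=
  ∃ A ∈ H, cliqueEdges A ⊆ G

/-- The family accepts the vertex set `s` if some member is contained in `s`. For members with
at least two vertices this says that the family accepts the complete graph on `s`. -/
def AcceptsSet {n : ℕ} (H : Finset (Finset (Fin n))) (s : Finset (Fin n)) : Prop :=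
  ∃ A ∈ H, A ⊆ s

/-- The family `H` is closed if it contains every set `Y` of at most `c` vertices such that,
after adding the complete graph on `Y` to a random graph, `H` rejects with probability at
most `ε`. -/
def IsCliqueClosed {n : ℕ} (p ε : ℝ) (c : ℕ) (H : Finset (Finset (Fin n))) : Prop :=
  ∀ Y : Finset (Fin n), Y.card ≤ c →
    prob p (fun G => ¬ AcceptsGraph H (G ∪ cliqueEdges Y)) ≤ ε → Y ∈ H

/-- The vertex sets of size at most `c`. -/
def smallSets (n c : ℕ) : Finset (Finset (Fin n)) :=
  Finset.univ.filter fun A => A.card ≤ c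

lemma mem_smallSets {n c : ℕ} {A : Finset (Fin n)} : A ∈ smallSets n c ↔ A.card ≤ c := by
  simp [smallSets]

open Finset in
lemma card_smallSets_le (n c : ℕ) (hn : 0 < n) : (smallSets n c).card ≤ (c + 1) * n ^ c := by
  have hsub : smallSets n c ⊆ (range (c + 1)).biUnion fun i => powersetCard i univ := by
    intro A hA
    simpa [Nat.lt_succ_iff] using mem_smallSets.1 hA
  refine (card_le_card hsub).trans ((card_biUnion_le).trans ?_)
  refine (sum_le_card_nsmul _ _ (n ^ c) fun i hi => ?_).trans (by simp)
  rw [card_powersetCard, card_univ, Fintype.card_fin]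
  exact (Nat.choose_le_pow n i).trans (Nat.pow_le_pow_right hn (by simpa [Nat.lt_succ_iff] using hi))

open Finset in
/-- Every family has a closed extension. Each set that has to be added changes the answer on a
random graph with probability at most `ε`. -/
theorem exists_cliqueClosed_extension {n : ℕ} {p ε : ℝ} (h0 : 0 ≤ p) (h1 : p ≤ 1) (hε : 0 ≤ ε)
    (c : ℕ) (H : Finset (Finset (Fin n))) (hH : H ⊆ smallSets n c) :
    ∃ H', H ⊆ H' ∧ H' ⊆ smallSets n c ∧ IsCliqueClosed p ε c H' ∧
      prob p (fun G => AcceptsGraph H' G ∧ ¬ AcceptsGraph H G) ≤ (smallSets n c).card * ε := by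
  suffices h : ∀ (m : ℕ) (H : Finset (Finset (Fin n))), H ⊆ smallSets n c →
      (smallSets n c \ H).card = m → ∃ H', H ⊆ H' ∧ H' ⊆ smallSets n c ∧ IsCliqueClosed p ε c H' ∧
      prob p (fun G => AcceptsGraph H' G ∧ ¬ AcceptsGraph H G) ≤ m * ε by
    obtain ⟨H', h₁, h₂, h₃, h₄⟩ := h _ H hH rfl
    refine ⟨H', h₁, h₂, h₃, h₄.trans ?_⟩
    gcongr
    exact sdiff_subset
  intro m
  induction m with
  | zero =>
    intro H hH hm
    refine ⟨H, subset_rfl, hH, fun Y hY _ => ?_, ?_⟩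
    · exact sdiff_eq_empty_iff_subset.1 (card_eq_zero.1 hm) (mem_smallSets.2 hY)
    · simp [prob_false]
  | succ m ih =>
    intro H hH hm
    by_cases hcl : IsCliqueClosed p ε c H
    · refine ⟨H, subset_rfl, hH, hcl, ?_⟩
      simp only [and_not_self, prob_false]
      positivity
    · unfold IsCliqueClosed at hcl
      push Not at hcl
      obtain ⟨Y, hYc, hYp, hYH⟩ := hcl
      have hYs : Y ∈ smallSets n c \ H := mem_sdiff.2 ⟨mem_smallSets.2 hYc, hYH⟩
      obtain ⟨H', h₁, h₂, h₃, h₄⟩ := ih (insert Y H)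
        (insert_subset (mem_smallSets.2 hYc) hH) (by
          rw [sdiff_insert, card_erase_of_mem hYs, hm]; rfl)
      refine ⟨H', (subset_insert _ _).trans h₁, h₂, h₃, ?_⟩
      have hstep : ∀ G, (AcceptsGraph H' G ∧ ¬ AcceptsGraph H G) →
          (AcceptsGraph H' G ∧ ¬ AcceptsGraph (insert Y H) G) ∨
            ¬ AcceptsGraph H (G ∪ cliqueEdges Y) := by
        rintro G ⟨hG', hG⟩
        by_cases hY : cliqueEdges Y ⊆ G
        · right
          rwa [union_eq_left.2 hY]
        · left
          refine ⟨hG', ?_⟩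
          rintro ⟨A, hA, hAG⟩
          rcases mem_insert.1 hA with rfl | hA
          · exact hY hAG
          · exact hG ⟨A, hA, hAG⟩
      refine (prob_mono h0 h1 hstep).trans ((prob_or_le h0 h1 _ _).trans ?_)
      push_cast
      linarith

/-- The inclusion-minimal members of `H` of size `a`. -/
def minimalSets {n : ℕ} (H : Finset (Finset (Fin n))) (a : ℕ) : Finset (Finset (Fin n)) :=
  H.filter fun A => A.card = a ∧ ∀ B ∈ H, ¬ B ⊂ A

/-- A closed family has few minimal members of each size: otherwise these contain a
clique-sunflower, whose core belongs to the closed family and contradicts minimality. -/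
theorem card_minimalSets_le {n a c : ℕ} {p L : ℝ} (hp0 : 0 < p) (hp1 : p ≤ 1) (hL : 1 ≤ L)
    (hac : a ≤ c) {H : Finset (Finset (Fin n))}
    (hH : IsCliqueClosed p (Real.exp (-(L / 10))) c H) :
    ((minimalSets H a).card : ℝ) ≤ (a * L) ^ a * (p ^ a.choose 2)⁻¹ := by
  by_contra! hlt
  obtain ⟨B, ⟨A, hA, hBA⟩, hB⟩ := exists_clique_sunflower hp0 hp1 hL (minimalSets H a)
    (fun A hA => (Finset.mem_filter.1 hA).2.1) hlt
  obtain ⟨-, hAa, hAmin⟩ := Finset.mem_filter.1 hA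
  refine hAmin B (hH B ?_ ?_) hBA
  · exact (Finset.card_le_card hBA.1).trans (hAa.le.trans hac)
  · refine (prob_mono hp0.le hp1 fun G hG A hA hAG => ?_).trans hB
    exact hG ⟨A, (Finset.mem_filter.1 hA).1, hAG⟩

lemma exists_mem_minimalSets {n : ℕ} {H : Finset (Finset (Fin n))} {s : Finset (Fin n)}
    (h : AcceptsSet H s) : ∃ A, A ∈ minimalSets H A.card ∧ A ⊆ s := by
  obtain ⟨A, hA, hAs⟩ := h
  obtain ⟨M, hM, hmin⟩ := Finset.exists_min_image (H.filter (· ⊆ s)) Finset.card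
    ⟨A, Finset.mem_filter.2 ⟨hA, hAs⟩⟩
  rw [Finset.mem_filter] at hM
  refine ⟨M, Finset.mem_filter.2 ⟨hM.1, rfl, fun B hB hBM => ?_⟩, hM.2⟩
  exact absurd (Finset.card_lt_card hBM)
    (not_lt.2 (hmin B (Finset.mem_filter.2 ⟨hB, hBM.1.trans hM.2⟩)))

lemma choose_sub_mul_pow_le {n k : ℕ} (hkn : k ≤ n) (a : ℕ) (ha : a ≤ k) :
    (n - a).choose (k - a) * n ^ a ≤ k ^ a * n.choose k := by
  induction a with
  | zero => simp
  | succ a ih =>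
    have ih := ih (by omega)
    have hpos : 0 < n - a := by omega
    refine Nat.le_of_mul_le_mul_left ?_ hpos
    have hid : (n - a) * (n - (a + 1)).choose (k - (a + 1)) = (n - a).choose (k - a) * (k - a) := by
      have := Nat.add_one_mul_choose_eq (n - (a + 1)) (k - (a + 1))
      rwa [show n - (a + 1) + 1 = n - a by omega, show k - (a + 1) + 1 = k - a by omega] at this
    have hratio : (k - a) * n ≤ k * (n - a) := by
      rw [Nat.sub_mul, Nat.mul_sub]
      exact Nat.sub_le_sub_left (by rw [mul_comm k a]; exact Nat.mul_le_mul_left a hkn) _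
    calc (n - a) * ((n - (a + 1)).choose (k - (a + 1)) * n ^ (a + 1))
        = ((n - a).choose (k - a) * n ^ a) * ((k - a) * n) := by
          rw [← mul_assoc, hid]; ring
      _ ≤ (k ^ a * n.choose k) * (k * (n - a)) := Nat.mul_le_mul ih hratio
      _ = _ := by ring

open Finset in
/-- A random `k`-set contains a given `a`-set with probability at most `(k / n) ^ a`. -/
lemma card_supersets_le {n k : ℕ} (hkn : k ≤ n) (hn : 0 < n) (A : Finset (Fin n)) :
    (((powersetCard k univ).filter fun s => A ⊆ s).card : ℝ) ≤
      ((k : ℝ) / n) ^ A.card * n.choose k := by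
  by_cases ha : A.card ≤ k
  · have h1 : ((powersetCard k univ).filter fun s => A ⊆ s).card
        ≤ (n - A.card).choose (k - A.card) := by
      have : (powersetCard (k - A.card) (univ \ A)).card = (n - A.card).choose (k - A.card) := by
        rw [card_powersetCard, card_sdiff_of_subset (subset_univ _), card_univ, Fintype.card_fin]
      rw [← this]
      refine card_le_card_of_injOn (fun s => s \ A) ?_ ?_
      · intro s hs
        simp only [coe_filter, mem_powersetCard, Set.mem_ofPred_eq] at hs
        simp only [mem_coe, mem_powersetCard]
        exact ⟨sdiff_subset_sdiff (subset_univ _) subset_rfl, by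
          rw [card_sdiff_of_subset hs.2, hs.1.2]⟩
      · intro s hs s' hs' h
        simp only [coe_filter, mem_powersetCard, Set.mem_ofPred_eq] at hs hs'
        rw [← sdiff_union_of_subset hs.2, ← sdiff_union_of_subset hs'.2]
        exact congrArg (· ∪ A) h
    have h2 := (Nat.mul_le_mul_right (n ^ A.card) h1).trans (choose_sub_mul_pow_le hkn _ ha)
    have hnpos : (0 : ℝ) < n := by exact_mod_cast hn
    rw [div_pow, div_mul_eq_mul_div, le_div_iff₀ (by positivity)]
    exact_mod_cast h2
  · have : (powersetCard k univ).filter (fun s => A ⊆ s) = ∅ := by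
      refine filter_eq_empty_iff.2 fun s hs hAs => ha ?_
      rw [← (mem_powersetCard.1 hs).2]
      exact card_le_card hAs
    rw [this]
    simp only [card_empty, Nat.cast_zero]
    positivity

lemma sum_Ioc_pow_le {y : ℝ} (hy0 : 0 ≤ y) (hy : y ≤ 1 / 2) (t c : ℕ) :
    ∑ a ∈ Finset.Ioc t c, y ^ a ≤ 2 * y ^ (t + 1) := by
  rcases lt_or_ge c t with h | h
  · rw [Finset.Ioc_eq_empty (by omega)]
    simp only [Finset.sum_empty]
    positivity
  · have : ∑ a ∈ Finset.Ioc t c, y ^ a ≤ 2 * y ^ (t + 1) - 2 * y ^ (c + 1) := by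
      induction c, h using Nat.le_induction with
      | base => simp
      | succ c hc ih =>
        rw [← Finset.insert_Ioc_right_eq_Ioc_add_one (by omega), Finset.sum_insert (by simp)]
        have : y ^ (c + 1 + 1) ≤ y ^ (c + 1) * (1 / 2) := by
          rw [pow_succ]; gcongr
        linarith
    have : 0 ≤ y ^ (c + 1) := by positivity
    linarith

open Finset in
/-- Few `k`-sets contain a minimal member with more than `t` vertices of a closed family. -/
theorem card_covered_le {n k c t : ℕ} {p L y : ℝ} (hkn : k ≤ n) (hn : 0 < n) (hp0 : 0 < p)
    (hp1 : p ≤ 1) (hL : 1 ≤ L) (hy0 : 0 ≤ y) (hy1 : y ≤ 1 / 2)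
    (hy : ∀ a ∈ Ioc 0 c, (a * L) ^ a * (p ^ a.choose 2)⁻¹ * ((k : ℝ) / n) ^ a ≤ y ^ a)
    {H : Finset (Finset (Fin n))} (hHc : H ⊆ smallSets n c)
    (hH : IsCliqueClosed p (Real.exp (-(L / 10))) c H) :
    (((powersetCard k univ).filter fun s =>
      ∃ A ∈ minimalSets H A.card, t < A.card ∧ A ⊆ s).card : ℝ) ≤
      2 * y ^ (t + 1) * n.choose k := by
  have hsub : ((powersetCard k univ).filter fun s =>
        ∃ A ∈ minimalSets H A.card, t < A.card ∧ A ⊆ s) ⊆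
      (Ioc t c).biUnion fun a => (minimalSets H a).biUnion fun A =>
        (powersetCard k univ).filter fun s => A ⊆ s := by
    intro s hs
    rw [mem_filter] at hs
    obtain ⟨hs, A, hA, htA, hAs⟩ := hs
    simp only [mem_biUnion, mem_Ioc, mem_filter]
    exact ⟨A.card, ⟨htA, mem_smallSets.1 (hHc (mem_filter.1 hA).1)⟩, A, hA, hs, hAs⟩
  calc _ ≤ ∑ a ∈ Ioc t c, ∑ A ∈ minimalSets H a,
        (((powersetCard k univ).filter fun s => A ⊆ s).card : ℝ) := by
        refine (Nat.cast_le.2 ((card_le_card hsub).trans (card_biUnion_le.trans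
          (sum_le_sum fun a _ => card_biUnion_le)))).trans ?_
        push_cast
        exact le_rfl
    _ ≤ ∑ a ∈ Ioc t c, y ^ a * n.choose k := by
        refine sum_le_sum fun a ha => ?_
        rw [mem_Ioc] at ha
        calc ∑ A ∈ minimalSets H a, (((powersetCard k univ).filter fun s => A ⊆ s).card : ℝ)
            ≤ ∑ A ∈ minimalSets H a, ((k : ℝ) / n) ^ a * n.choose k := by
              refine sum_le_sum fun A hA => ?_
              have := card_supersets_le hkn hn A
              rwa [(mem_filter.1 hA).2.1] at this
          _ = (minimalSets H a).card * (((k : ℝ) / n) ^ a * n.choose k) := by simp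
          _ ≤ ((a * L) ^ a * (p ^ a.choose 2)⁻¹) * (((k : ℝ) / n) ^ a * n.choose k) := by
              gcongr
              exact card_minimalSets_le hp0 hp1 hL ha.2 hH
          _ = ((a * L) ^ a * (p ^ a.choose 2)⁻¹ * ((k : ℝ) / n) ^ a) * n.choose k := by ring
          _ ≤ _ := by
              gcongr
              exact hy a (mem_Ioc.2 ⟨by omega, ha.2⟩)
    _ = (∑ a ∈ Ioc t c, y ^ a) * n.choose k := by rw [sum_mul]
    _ ≤ _ := by
        gcongr
        exact sum_Ioc_pow_le hy0 hy1 t c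

/-! ### Approximation of monotone circuits -/

/-- The circuit input that describes the graph with edge set `G`. -/
def inputOf {n : ℕ} (G : Finset (PotentialEdge n)) (e : PotentialEdge n) : Bool :=
  decide (e ∈ G)

/-- The family that represents a wire, given families that represent the earlier gates. -/
def MonoSource.family {n m : ℕ} (F : Fin m → Finset (Finset (Fin n))) :
    MonoSource (PotentialEdge n) m → Finset (Finset (Fin n))
  | .input e => {e.1.toFinset}
  | .const b => if b then {∅} else ∅
  | .gate j => F j

lemma MonoSource.family_subset {n m t : ℕ} (ht : 2 ≤ t) {F : Fin m → Finset (Finset (Fin n))}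
    (hF : ∀ j, F j ⊆ smallSets n t) (a : MonoSource (PotentialEdge n) m) :
    a.family F ⊆ smallSets n t := by
  cases a with
  | input e =>
    simp only [family, Finset.singleton_subset_iff, mem_smallSets]
    rw [Sym2.card_toFinset_of_not_isDiag _ e.2]
    exact ht
  | const b => cases b <;> simp [family, mem_smallSets]
  | gate j => exact hF j

lemma MonoSource.acceptsSet_family {n m : ℕ} {F : Fin m → Finset (Finset (Fin n))}
    {val : Fin m → Bool} {s : Finset (Fin n)} (h : ∀ j, val j = true → AcceptsSet (F j) s)
    (a : MonoSource (PotentialEdge n) m) (ha : a.eval (inputOf (cliqueEdges s)) val = true) :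
    AcceptsSet (a.family F) s := by
  cases a with
  | input e =>
    have he : e ∈ cliqueEdges s := by simpa [eval, inputOf] using ha
    refine ⟨e.1.toFinset, by simp [family], fun v hv => ?_⟩
    exact mem_cliqueEdges.1 he v (Sym2.mem_toFinset.1 hv)
  | const b =>
    have hb : b = true := ha
    exact ⟨∅, by simp [family, hb], by simp⟩
  | gate j => exact h j ha

lemma MonoSource.eval_of_acceptsGraph {n m : ℕ} {F : Fin m → Finset (Finset (Fin n))}
    {val : Fin m → Bool} {G : Finset (PotentialEdge n)}
    (h : ∀ j, AcceptsGraph (F j) G → val j = true) (a : MonoSource (PotentialEdge n) m)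
    (ha : AcceptsGraph (a.family F) G) : a.eval (inputOf G) val = true := by
  cases a with
  | input e =>
    obtain ⟨A, hA, hAG⟩ := ha
    rw [family, Finset.mem_singleton] at hA
    subst hA
    simpa [eval, inputOf] using hAG (mem_cliqueEdges.2 fun v hv => Sym2.mem_toFinset.2 hv)
  | const b =>
    obtain ⟨A, hA, -⟩ := ha
    cases b
    · simp [family] at hA
    · rfl
  | gate j => exact h j ha

open Finset in
/-- The family of a gate before it is closed: a union of families for an OR gate, and the
pairwise unions of members for an AND gate. -/
def MonoGate.family {n m : ℕ} (F : Fin m → Finset (Finset (Fin n))) :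
    MonoGate (PotentialEdge n) m → Finset (Finset (Fin n))
  | .and a b => image₂ (· ∪ ·) (a.family F) (b.family F)
  | .or a b => a.family F ∪ b.family F

lemma MonoGate.family_subset {n m t c : ℕ} (ht : 2 ≤ t) (htc : 2 * t ≤ c)
    {F : Fin m → Finset (Finset (Fin n))} (hF : ∀ j, F j ⊆ smallSets n t)
    (g : MonoGate (PotentialEdge n) m) : g.family F ⊆ smallSets n c := by
  intro A hA
  rw [mem_smallSets]
  cases g with
  | and a b =>
    obtain ⟨B, hB, C, hC, rfl⟩ := Finset.mem_image₂.1 hA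
    have h1 := mem_smallSets.1 (a.family_subset ht hF hB)
    have h2 := mem_smallSets.1 (b.family_subset ht hF hC)
    have := Finset.card_union_le B C
    omega
  | or a b =>
    rcases Finset.mem_union.1 hA with hA | hA
    · have := mem_smallSets.1 (a.family_subset ht hF hA)
      omega
    · have := mem_smallSets.1 (b.family_subset ht hF hA)
      omega

lemma MonoGate.acceptsSet_family {n m : ℕ} {F : Fin m → Finset (Finset (Fin n))}
    {val : Fin m → Bool} {s : Finset (Fin n)} (h : ∀ j, val j = true → AcceptsSet (F j) s)
    (g : MonoGate (PotentialEdge n) m) (hg : g.eval (inputOf (cliqueEdges s)) val = true) :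
    AcceptsSet (g.family F) s := by
  cases g with
  | and a b =>
    simp only [eval, Bool.and_eq_true] at hg
    obtain ⟨A, hA, hAs⟩ := a.acceptsSet_family h hg.1
    obtain ⟨B, hB, hBs⟩ := b.acceptsSet_family h hg.2
    exact ⟨A ∪ B, Finset.mem_image₂_of_mem hA hB, Finset.union_subset hAs hBs⟩
  | or a b =>
    simp only [eval, Bool.or_eq_true] at hg
    rcases hg with hg | hg
    · obtain ⟨A, hA, hAs⟩ := a.acceptsSet_family h hg
      exact ⟨A, Finset.mem_union_left _ hA, hAs⟩
    · obtain ⟨A, hA, hAs⟩ := b.acceptsSet_family h hg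
      exact ⟨A, Finset.mem_union_right _ hA, hAs⟩

lemma MonoGate.eval_of_acceptsGraph {n m : ℕ} {F : Fin m → Finset (Finset (Fin n))}
    {val : Fin m → Bool} {G : Finset (PotentialEdge n)}
    (h : ∀ j, AcceptsGraph (F j) G → val j = true) (g : MonoGate (PotentialEdge n) m)
    (hg : AcceptsGraph (g.family F) G) : g.eval (inputOf G) val = true := by
  obtain ⟨A, hA, hAG⟩ := hg
  cases g with
  | and a b =>
    obtain ⟨B, hB, C, hC, rfl⟩ := Finset.mem_image₂.1 hA
    simp only [eval, Bool.and_eq_true]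
    exact ⟨a.eval_of_acceptsGraph h ⟨B, hB, (cliqueEdges_mono Finset.subset_union_left).trans hAG⟩,
      b.eval_of_acceptsGraph h ⟨C, hC, (cliqueEdges_mono Finset.subset_union_right).trans hAG⟩⟩
  | or a b =>
    simp only [eval, Bool.or_eq_true]
    rcases Finset.mem_union.1 hA with hA | hA
    · exact Or.inl (a.eval_of_acceptsGraph h ⟨A, hA, hAG⟩)
    · exact Or.inr (b.eval_of_acceptsGraph h ⟨A, hA, hAG⟩)

open Finset in
/-- A family of sets of size at most `c` is replaced by one of sets of size at most `t`: it is
closed, and the larger sets are then dropped. Closing costs little on random graphs, and dropping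
costs little on random `k`-cliques. -/
theorem exists_trimmed_closure {n k c : ℕ} {p L y : ℝ} (hkn : k ≤ n) (hn : 0 < n) (hp0 : 0 < p)
    (hp1 : p ≤ 1) (hL : 1 ≤ L) (hy0 : 0 ≤ y) (hy1 : y ≤ 1 / 2)
    (hy : ∀ a ∈ Ioc 0 c, (a * L) ^ a * (p ^ a.choose 2)⁻¹ * ((k : ℝ) / n) ^ a ≤ y ^ a)
    (t : ℕ) {H : Finset (Finset (Fin n))} (hH : H ⊆ smallSets n c) :
    ∃ (H' : Finset (Finset (Fin n))) (BP : Finset (Finset (Fin n))), H' ⊆ smallSets n t ∧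
      (BP.card : ℝ) ≤ 2 * y ^ (t + 1) * n.choose k ∧
      (∀ s, s.card = k → s ∉ BP → AcceptsSet H s → AcceptsSet H' s) ∧
      prob p (fun G => AcceptsGraph H' G ∧ ¬ AcceptsGraph H G) ≤
        (smallSets n c).card * Real.exp (-(L / 10)) := by
  classical
  obtain ⟨K, hHK, hKc, hK, hKp⟩ :=
    exists_cliqueClosed_extension hp0.le hp1 (Real.exp_pos (-(L / 10))).le c H hH
  refine ⟨K.filter fun A => A.card ≤ t, _, fun A hA => mem_smallSets.2 (mem_filter.1 hA).2,
    card_covered_le hkn hn hp0 hp1 hL hy0 hy1 hy hKc hK, ?_, ?_⟩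
  · rintro s hsk hs ⟨A, hA, hAs⟩
    obtain ⟨M, hM, hMs⟩ := exists_mem_minimalSets (H := K) ⟨A, hHK hA, hAs⟩
    refine ⟨M, mem_filter.2 ⟨(mem_filter.1 hM).1, ?_⟩, hMs⟩
    by_contra! htM
    exact hs (mem_filter.2 ⟨mem_powersetCard.2 ⟨subset_univ _, hsk⟩, M, hM, htM, hMs⟩)
  · refine le_trans (prob_mono hp0.le hp1 ?_) hKp
    rintro G ⟨⟨A, hA, hAG⟩, hG⟩
    exact ⟨⟨A, (mem_filter.1 hA).1, hAG⟩, hG⟩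

open Finset in
/-- Razborov's approximation: all gates of a monotone circuit are simultaneously represented by
families of sets of size at most `t`, up to errors on few `k`-cliques and on random graphs
with small probability. -/
theorem exists_approximation {n k c t m : ℕ} {p L y : ℝ} (hkn : k ≤ n) (hn : 0 < n) (hp0 : 0 < p)
    (hp1 : p ≤ 1) (hL : 1 ≤ L) (hy0 : 0 ≤ y) (hy1 : y ≤ 1 / 2)
    (hy : ∀ a ∈ Ioc 0 c, (a * L) ^ a * (p ^ a.choose 2)⁻¹ * ((k : ℝ) / n) ^ a ≤ y ^ a)
    (ht : 2 ≤ t) (htc : 2 * t ≤ c) (P : MonoGates (PotentialEdge n) m) :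
    ∃ (F : Fin m → Finset (Finset (Fin n))) (BP : Finset (Finset (Fin n)))
      (BN : Finset (PotentialEdge n) → Prop), (∀ j, F j ⊆ smallSets n t) ∧
      (BP.card : ℝ) ≤ m * (2 * y ^ (t + 1) * n.choose k) ∧
      prob p BN ≤ m * ((smallSets n c).card * Real.exp (-(L / 10))) ∧
      (∀ s, s.card = k → s ∉ BP → ∀ j, P.values (inputOf (cliqueEdges s)) j = true →
        AcceptsSet (F j) s) ∧
      (∀ G, ¬ BN G → ∀ j, AcceptsGraph (F j) G → P.values (inputOf G) j = true) := by
  classical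
  induction P with
  | nil => exact ⟨Fin.elim0, ∅, fun _ => False, fun j => j.elim0, by simp, by simp [prob_false],
      fun _ _ _ j => j.elim0, fun _ _ j => j.elim0⟩
  | @snoc m P g ih =>
    obtain ⟨F, BP, BN, hF, hBP, hBN, hpos, hneg⟩ := ih
    obtain ⟨F', BP', hF', hBP', hpos', hneg'⟩ := exists_trimmed_closure hkn hn hp0 hp1 hL hy0 hy1 hy
      t (g.family_subset ht htc hF)
    refine ⟨Fin.snoc (α := fun _ => Finset (Finset (Fin n))) F F', BP ∪ BP',
      fun G => BN G ∨ (AcceptsGraph F' G ∧ ¬ AcceptsGraph (g.family F) G), ?_, ?_, ?_, ?_, ?_⟩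
    · intro j
      induction j using Fin.lastCases with
      | last => simpa using hF'
      | cast j => simpa using hF j
    · have : ((BP ∪ BP').card : ℝ) ≤ BP.card + BP'.card := by exact_mod_cast card_union_le _ _
      push_cast
      linarith
    · refine (prob_or_le hp0.le hp1 _ _).trans ?_
      push_cast
      linarith
    · intro s hsk hs j hj
      rw [mem_union, not_or] at hs
      induction j using Fin.lastCases with
      | last =>
        simp only [MonoGates.values, Fin.snoc_last] at hj ⊢
        exact hpos' s hsk hs.2 (g.acceptsSet_family (hpos s hsk hs.1) hj)
      | cast j =>
        simp only [MonoGates.values, Fin.snoc_castSucc] at hj ⊢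
        exact hpos s hsk hs.1 j hj
    · intro G hG j hj
      rw [not_or] at hG
      induction j using Fin.lastCases with
      | last =>
        simp only [MonoGates.values, Fin.snoc_last] at hj ⊢
        refine g.eval_of_acceptsGraph (hneg G hG.1) ?_
        by_contra h
        exact hG.2 ⟨hj, h⟩
      | cast j =>
        simp only [MonoGates.values, Fin.snoc_castSucc] at hj ⊢
        exact hneg G hG.1 j hj

/-! ### The lower bound in terms of the parameters -/

lemma kClique_inputOf {n k : ℕ} (G : Finset (PotentialEdge n)) :
    kClique n k (inputOf G) = true ↔ ∃ s : Finset (Fin n), s.card = k ∧ cliqueEdges s ⊆ G := by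
  simp only [kClique, decide_eq_true_eq]
  refine exists_congr fun s => ?_
  rw [SimpleGraph.isNClique_iff, and_comm]
  refine and_congr_right fun _ => ⟨fun h e he => ?_, fun h v hv w hw hvw => ?_⟩
  · obtain ⟨e, hd⟩ := e
    induction e using Sym2.ind with
    | _ v w =>
      rw [mem_cliqueEdges] at he
      have hvw : v ≠ w := fun h => hd (Sym2.mk_isDiag_iff.2 h)
      have hadj := h (he v (by simp)) (he w (by simp)) hvw
      rw [graphOfInput, SimpleGraph.fromEdgeSet_adj] at hadj
      obtain ⟨⟨hd', hx⟩, -⟩ := hadj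
      simpa [inputOf] using hx
  · rw [graphOfInput, SimpleGraph.fromEdgeSet_adj]
    have hd : ¬ (s(v, w)).IsDiag := fun h => hvw (Sym2.mk_isDiag_iff.1 h)
    refine ⟨⟨hd, ?_⟩, hvw⟩
    have : (⟨s(v, w), hd⟩ : PotentialEdge n) ∈ G := h (mem_cliqueEdges.2 fun u hu => by
      rcases Sym2.mem_iff.1 hu with rfl | rfl <;> assumption)
    simpa [inputOf] using this

open Finset in
lemma half_le_prob_no_clique {n k : ℕ} {p : ℝ} (hp0 : 0 ≤ p) (hp1 : p ≤ 1)
    (hpk : n.choose k * p ^ k.choose 2 ≤ 1 / 2) :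
    1 / 2 ≤ prob p (fun G : Finset (PotentialEdge n) => kClique n k (inputOf G) = false) := by
  have h1 : (1 : ℝ) ≤ prob p (fun G : Finset (PotentialEdge n) => kClique n k (inputOf G) = false)
      + prob p (fun G => ∃ s ∈ powersetCard k (univ : Finset (Fin n)), cliqueEdges s ⊆ G) := by
    rw [← prob_true (E := PotentialEdge n) p]
    refine (prob_mono hp0 hp1 fun G _ => ?_).trans (prob_or_le hp0 hp1 _ _)
    rw [← Bool.not_eq_true, kClique_inputOf]
    by_cases h : ∃ s : Finset (Fin n), s.card = k ∧ cliqueEdges s ⊆ G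
    · obtain ⟨s, hs, hsG⟩ := h
      exact Or.inr ⟨s, mem_powersetCard.2 ⟨subset_univ _, hs⟩, hsG⟩
    · exact Or.inl h
  have h2 := prob_exists_le hp0 hp1 (powersetCard k (univ : Finset (Fin n)))
    (fun s (G : Finset (PotentialEdge n)) => cliqueEdges s ⊆ G)
  have h3 : ∑ s ∈ powersetCard k (univ : Finset (Fin n)),
      prob p (fun G : Finset (PotentialEdge n) => cliqueEdges s ⊆ G)
      = n.choose k * p ^ k.choose 2 := by
    have : ∀ s ∈ powersetCard k (univ : Finset (Fin n)),
        prob p (fun G : Finset (PotentialEdge n) => cliqueEdges s ⊆ G) = p ^ k.choose 2 := by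
      intro s hs
      rw [prob_subset, card_cliqueEdges, (mem_powersetCard.1 hs).2]
    rw [sum_congr rfl this]
    simp
  linarith

open Finset in
/-- The lower bound with all parameters free. The family of the output either contains `∅`, and
then accepts all the random graphs without a `k`-clique, or it rejects most `k`-cliques. -/
theorem size_lower_bound {n k c t : ℕ} {p L y : ℝ} (hkn : k ≤ n) (hn : 0 < n) (hp0 : 0 < p)
    (hp1 : p ≤ 1) (hL : 1 ≤ L) (hy0 : 0 ≤ y) (hy1 : y ≤ 1 / 4)
    (hy : ∀ a ∈ Ioc 0 c, (a * L) ^ a * (p ^ a.choose 2)⁻¹ * ((k : ℝ) / n) ^ a ≤ y ^ a)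
    (ht : 2 ≤ t) (htc : 2 * t ≤ c) (hpk : n.choose k * p ^ k.choose 2 ≤ 1 / 2)
    (C : MonotoneCircuit (PotentialEdge n)) (hC : C.Computes (kClique n k)) :
    1 / 2 ≤ (C.size + 1) * ((smallSets n c).card * Real.exp (-(L / 10))) ∨
      1 / 2 ≤ C.size * (2 * y ^ (t + 1)) := by
  classical
  obtain ⟨F, BP, BN, hF, hBP, hBN, hpos, hneg⟩ := exists_approximation hkn hn hp0 hp1 hL hy0
    (by linarith) hy ht htc C.gates
  have hFc : C.output.family F ⊆ smallSets n c := fun A hA => by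
    have := mem_smallSets.1 (C.output.family_subset ht hF hA)
    exact mem_smallSets.2 (by omega)
  obtain ⟨K, BP', hK0, hBP', hpos', hneg'⟩ := exists_trimmed_closure hkn hn hp0 hp1 hL hy0
    (by linarith) hy 0 hFc
  -- Trimming at size `0` leaves `∅` or nothing.
  by_cases hK : ∅ ∈ K
  · left
    have hsub : ∀ G : Finset (PotentialEdge n), kClique n k (inputOf G) = false →
        BN G ∨ (AcceptsGraph K G ∧ ¬ AcceptsGraph (C.output.family F) G) := by
      intro G hG
      by_contra! h
      have hacc : AcceptsGraph (C.output.family F) G :=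
        h.2 ⟨∅, hK, fun e he => by
          obtain ⟨e, hd⟩ := e
          induction e using Sym2.ind with
          | _ v w => simpa using mem_cliqueEdges.1 he v (by simp)⟩
      have := C.output.eval_of_acceptsGraph (hneg G h.1) hacc
      rw [← hC, MonotoneCircuit.eval, this] at hG
      exact absurd hG (by simp)
    have h1 := (half_le_prob_no_clique hp0.le hp1 hpk).trans
      ((prob_mono hp0.le hp1 hsub).trans (prob_or_le hp0.le hp1 _ _))
    linarith
  · right
    have hsub : powersetCard k univ ⊆ BP ∪ BP' := by
      intro s hs
      have hsk := (mem_powersetCard.1 hs).2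
      by_contra h
      rw [mem_union, not_or] at h
      have hev : C.eval (inputOf (cliqueEdges s)) = true := by
        rw [hC, kClique_inputOf]
        exact ⟨s, hsk, subset_rfl⟩
      obtain ⟨A, hA, -⟩ := hpos' s hsk h.2 (C.output.acceptsSet_family (hpos s hsk h.1) hev)
      have : A = ∅ := by simpa using mem_smallSets.1 (hK0 hA)
      exact hK (this ▸ hA)
    have h1 : (n.choose k : ℝ) ≤ BP.card + BP'.card := by
      have := (card_le_card hsub).trans (card_union_le _ _)
      rw [card_powersetCard, card_univ, Fintype.card_fin] at this
      exact_mod_cast this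
    have hchoose : (0 : ℝ) < n.choose k := by exact_mod_cast Nat.choose_pos hkn
    have h2 : 1 * (n.choose k : ℝ) ≤
        (C.size * (2 * y ^ (t + 1)) + 2 * y ^ (0 + 1)) * n.choose k := by linarith
    have h3 := le_of_mul_le_mul_right h2 hchoose
    rw [zero_add, pow_one] at h3
    linarith

/-! ### Choice of the parameters -/

open Filter in
lemma eventually_parameters {δ : ℝ} (hδ0 : 0 < δ) (hδ1 : δ < 1 / 3) :
    ∀ᶠ n : ℕ in atTop, 4 / δ + 1 ≤ (n : ℝ) ^ (1 / 3 - δ) ∧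
      40 * Real.log n ≤ (n : ℝ) ^ (δ / 2) ∧ (n : ℝ) ^ (-(3 * δ / 2)) ≤ 1 / 4 := by
  have h1 := (tendsto_rpow_atTop (y := 1 / 3 - δ) (by linarith)).eventually_ge_atTop (4 / δ + 1)
  have h2 := (isLittleO_log_rpow_atTop (r := δ / 2) (by linarith)).bound
    (c := 1 / 40) (by norm_num)
  have h3 := (tendsto_rpow_neg_atTop (y := 3 * δ / 2) (by linarith)).eventually_le_const
    (show (0 : ℝ) < 1 / 4 by norm_num)
  filter_upwards [tendsto_natCast_atTop_atTop.eventually h1,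
    tendsto_natCast_atTop_atTop.eventually h2, tendsto_natCast_atTop_atTop.eventually h3]
    with n h1 h2 h3
  refine ⟨h1, ?_, h3⟩
  rw [Real.norm_eq_abs, Real.norm_eq_abs, abs_of_nonneg (a := (n : ℝ) ^ (δ / 2))
    (Real.rpow_nonneg (Nat.cast_nonneg n) _)] at h2
  have := le_abs_self (Real.log n)
  linarith

/-- With edge probability `n ^ (-2 / (k - 1))` the expected number of `k`-cliques is at most
`1 / k!`. -/
lemma choose_mul_edge_prob_le {n k : ℕ} (hn : 0 < n) (hk : 2 ≤ k) :
    n.choose k * ((n : ℝ) ^ (-2 / ((k : ℝ) - 1))) ^ k.choose 2 ≤ 1 / 2 := by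
  have hn0 : (0 : ℝ) < n := by exact_mod_cast hn
  have hk2 : (2 : ℝ) ≤ k := by exact_mod_cast hk
  have hp : ((n : ℝ) ^ (-2 / ((k : ℝ) - 1))) ^ k.choose 2 = ((n : ℝ) ^ k)⁻¹ := by
    rw [← Real.rpow_mul_natCast hn0.le, Nat.cast_choose_two, ← Real.rpow_natCast,
      ← Real.rpow_neg hn0.le]
    congr 1
    have : (k : ℝ) - 1 ≠ 0 := by linarith
    field_simp
  rw [hp]
  have hfact : (2 : ℝ) ≤ k.factorial := by
    exact_mod_cast Nat.factorial_two ▸ Nat.factorial_le hk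
  calc n.choose k * ((n : ℝ) ^ k)⁻¹ ≤ ((n : ℝ) ^ k / k.factorial) * ((n : ℝ) ^ k)⁻¹ := by
        gcongr
        exact Nat.choose_le_pow_div k n
    _ = 1 / k.factorial := by field_simp
    _ ≤ 1 / 2 := by gcongr

/-- The expected number of minimal sets of size `a` in a random `k`-set decays geometrically,
because `k ^ 3 ≤ n ^ (1 - 3 * δ)`. -/
lemma minimal_sets_bound {n k a : ℕ} {δ : ℝ} (hδ0 : 0 < δ) (hδ1 : δ < 1 / 3) (hn : 1 < n)
    (hk : 2 ≤ k) (hkn : (k : ℝ) ≤ (n : ℝ) ^ (1 / 3 - δ))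
    (hlog : 40 * Real.log n ≤ (n : ℝ) ^ (δ / 2)) (hak : (a : ℝ) ≤ δ * k) :
    (a * (40 * k * Real.log n)) ^ a * (((n : ℝ) ^ (-2 / ((k : ℝ) - 1))) ^ a.choose 2)⁻¹ *
      ((k : ℝ) / n) ^ a ≤ ((n : ℝ) ^ (-(3 * δ / 2))) ^ a := by
  have hn1 : (1 : ℝ) < n := by exact_mod_cast hn
  have hn0 : (0 : ℝ) < n := by linarith
  have hk2 : (2 : ℝ) ≤ k := by exact_mod_cast hk
  have hln : 0 < Real.log n := Real.log_pos hn1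
  have hp : (((n : ℝ) ^ (-2 / ((k : ℝ) - 1))) ^ a.choose 2)⁻¹ ≤ ((n : ℝ) ^ δ) ^ a := by
    rw [← Real.rpow_mul_natCast hn0.le, Nat.cast_choose_two, ← Real.rpow_mul_natCast hn0.le,
      ← Real.rpow_neg hn0.le]
    refine Real.rpow_le_rpow_of_exponent_le hn1.le ?_
    have hk1 : (0 : ℝ) < (k : ℝ) - 1 := by linarith
    have e : -(-2 / ((k : ℝ) - 1) * ((a : ℝ) * (a - 1) / 2)) = ((a : ℝ) - 1) / (k - 1) * a := by
      field_simp
    rw [e]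
    refine mul_le_mul_of_nonneg_right ?_ (Nat.cast_nonneg a)
    rw [div_le_iff₀ hk1]
    linarith
  have hbase : (a * (40 * k * Real.log n)) * (n : ℝ) ^ δ * ((k : ℝ) / n)
      ≤ (n : ℝ) ^ (-(3 * δ / 2)) := by
    have hak' : (a : ℝ) ≤ k := hak.trans (by nlinarith)
    have hk3 : (k : ℝ) ^ 3 ≤ (n : ℝ) ^ (1 - 3 * δ) := by
      calc (k : ℝ) ^ 3 ≤ ((n : ℝ) ^ (1 / 3 - δ)) ^ 3 := by gcongr
        _ = (n : ℝ) ^ (1 - 3 * δ) := by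
          rw [← Real.rpow_mul_natCast hn0.le]; congr 1; push_cast; ring
    calc (a * (40 * k * Real.log n)) * (n : ℝ) ^ δ * ((k : ℝ) / n)
        ≤ (k * (40 * k * Real.log n)) * (n : ℝ) ^ δ * ((k : ℝ) / n) := by gcongr
      _ = (40 * Real.log n) * (k : ℝ) ^ 3 * ((n : ℝ) ^ δ * (n : ℝ) ^ (-1 : ℝ)) := by
          rw [Real.rpow_neg_one]; field_simp
      _ ≤ (n : ℝ) ^ (δ / 2) * (n : ℝ) ^ (1 - 3 * δ) * ((n : ℝ) ^ δ * (n : ℝ) ^ (-1 : ℝ)) := by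
          gcongr
      _ = (n : ℝ) ^ (-(3 * δ / 2)) := by
          rw [← Real.rpow_add hn0, ← Real.rpow_add hn0, ← Real.rpow_add hn0]
          congr 1
          ring
  calc _ ≤ (a * (40 * k * Real.log n)) ^ a * ((n : ℝ) ^ δ) ^ a * ((k : ℝ) / n) ^ a := by gcongr
    _ = ((a * (40 * k * Real.log n)) * (n : ℝ) ^ δ * ((k : ℝ) / n)) ^ a := by
        simp only [mul_pow]
    _ ≤ _ := pow_le_pow_left₀ (by positivity) hbase a

theorem theorem3p23 (δ : ℝ) (hδ_pos : 0 < δ) (hδ_lt : δ < 1 / 3) :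
    ∃ c : ℝ, 0 < c ∧ ∃ N : ℕ, ∀ n : ℕ, N ≤ n → ∀ k : ℕ, k = ⌊(n : ℝ) ^ (1 / 3 - δ)⌋₊ →
      ∀ C : MonotoneCircuit (PotentialEdge n), C.Computes (kClique n k) →
        c * (n : ℝ) ^ (δ ^ 2 * (k : ℝ) / 2) ≤ (C.size : ℝ) := by
  obtain ⟨N, hN⟩ := Filter.eventually_atTop.1 (eventually_parameters hδ_pos hδ_lt)
  refine ⟨1 / 4, by norm_num, N + 1, fun n hn k hk C hC => ?_⟩
  obtain ⟨hbig, hlog, hy1⟩ := hN n (by omega)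
  have hn1 : (1 : ℝ) ≤ n := by exact_mod_cast (show 1 ≤ n by omega)
  have hn0 : (0 : ℝ) < n := by linarith
  have hkle : (k : ℝ) ≤ (n : ℝ) ^ (1 / 3 - δ) := by
    rw [hk]; exact Nat.floor_le (Real.rpow_nonneg hn0.le _)
  have hδk' : 4 / δ ≤ k := by
    have := Nat.lt_floor_add_one ((n : ℝ) ^ (1 / 3 - δ))
    rw [← hk] at this
    linarith
  have hδk : 4 ≤ δ * k := by rw [div_le_iff₀ hδ_pos] at hδk'; linarith
  have hk12 : (12 : ℝ) ≤ k := by nlinarith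
  have hk12' : 12 ≤ k := by exact_mod_cast hk12
  have hkn : (k : ℝ) ≤ n := hkle.trans <| by
    calc (n : ℝ) ^ (1 / 3 - δ) ≤ (n : ℝ) ^ (1 : ℝ) :=
          Real.rpow_le_rpow_of_exponent_le hn1 (by linarith)
      _ = n := Real.rpow_one _
  have hkn' : k ≤ n := by exact_mod_cast hkn
  have hln1 : 1 / 2 ≤ Real.log n := by
    rw [Real.le_log_iff_exp_le hn0]
    have h := Real.exp_le_exp.2 (show (1 / 2 : ℝ) ≤ 1 by norm_num)
    have := Real.exp_one_lt_d9
    linarith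
  set c := ⌊δ * k⌋₊ with hc
  have hcle : (c : ℝ) ≤ δ * k := Nat.floor_le (by linarith)
  have hc4 : 4 ≤ c := Nat.le_floor (by exact_mod_cast hδk)
  have hck : c + 1 ≤ k := by
    have : (c : ℝ) + 1 ≤ k := by nlinarith
    exact_mod_cast this
  have hL : (1 : ℝ) ≤ 40 * k * Real.log n := by nlinarith
  have hyle : ∀ a ∈ Finset.Ioc 0 c, (a * (40 * k * Real.log n)) ^ a *
      (((n : ℝ) ^ (-2 / ((k : ℝ) - 1))) ^ a.choose 2)⁻¹ * ((k : ℝ) / n) ^ a ≤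
      ((n : ℝ) ^ (-(3 * δ / 2))) ^ a := by
    intro a ha
    refine minimal_sets_bound hδ_pos hδ_lt (by omega) (by omega) hkle hlog ?_
    exact (Nat.cast_le.2 (Finset.mem_Ioc.1 ha).2).trans hcle
  have hp1 : (n : ℝ) ^ (-2 / ((k : ℝ) - 1)) ≤ 1 :=
    Real.rpow_le_one_of_one_le_of_nonpos hn1
      (div_nonpos_of_nonpos_of_nonneg (by norm_num) (by linarith))
  rcases size_lower_bound hkn' (by omega) (Real.rpow_pos_of_pos hn0 _) hp1 hL
    (Real.rpow_nonneg hn0.le _) hy1 hyle (t := c / 2) (by omega) (by omega)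
    (choose_mul_edge_prob_le (by omega) (by omega)) C hC with h | h
  · by_contra! hlt
    have hexp : Real.exp (-(40 * k * Real.log n / 10)) = ((n : ℝ) ^ (4 * k))⁻¹ := by
      rw [Real.exp_neg, ← Real.exp_log (pow_pos hn0 (4 * k)), Real.log_pow]
      congr 2
      push_cast
      ring
    have hsmall : ((smallSets n c).card : ℝ) ≤ (n : ℝ) ^ (2 * k) := by
      have h1 : (smallSets n c).card ≤ n ^ (2 * k) := by
        calc (smallSets n c).card ≤ (c + 1) * n ^ c := card_smallSets_le n c (by omega)
          _ ≤ n * n ^ c := Nat.mul_le_mul_right _ (by omega)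
          _ = n ^ (c + 1) := (pow_succ' n c).symm
          _ ≤ n ^ (2 * k) := Nat.pow_le_pow_right (by omega) (by omega)
      exact_mod_cast h1
    have hpow : (n : ℝ) ^ (δ ^ 2 * (k : ℝ) / 2) ≤ (n : ℝ) ^ k := by
      rw [← Real.rpow_natCast (n : ℝ) k]
      refine Real.rpow_le_rpow_of_exponent_le hn1 ?_
      nlinarith
    have hnk : (12 : ℝ) ≤ (n : ℝ) ^ k :=
      (hk12.trans hkn).trans (le_self_pow₀ hn1 (by omega))
    rw [hexp] at h
    have hsize : (C.size : ℝ) + 1 ≤ (n : ℝ) ^ k := by linarith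
    have : (C.size + 1) * ((smallSets n c).card * ((n : ℝ) ^ (4 * k))⁻¹) ≤ ((n : ℝ) ^ k)⁻¹ := by
      calc _ ≤ (n : ℝ) ^ k * ((n : ℝ) ^ (2 * k) * ((n : ℝ) ^ (4 * k))⁻¹) := by gcongr
        _ = ((n : ℝ) ^ k)⁻¹ := by
          rw [mul_comm 2 k, mul_comm 4 k, pow_mul, pow_mul]
          field_simp
    have h12 : ((n : ℝ) ^ k)⁻¹ ≤ 12⁻¹ := inv_anti₀ (by norm_num) hnk
    norm_num at h12
    linarith
  · have hyt : ((n : ℝ) ^ (-(3 * δ / 2))) ^ (c / 2 + 1) ≤ ((n : ℝ) ^ (δ ^ 2 * (k : ℝ) / 2))⁻¹ := by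
      rw [← Real.rpow_mul_natCast hn0.le, ← Real.rpow_neg hn0.le]
      refine Real.rpow_le_rpow_of_exponent_le hn1 ?_
      have h1 : δ * k < c + 1 := Nat.lt_floor_add_one _
      have h2 : ((c : ℝ) + 1) ≤ 2 * ((c / 2 + 1 : ℕ) : ℝ) := by
        exact_mod_cast (show c + 1 ≤ 2 * (c / 2 + 1) by omega)
      have h3 : δ * (δ * k) ≤ δ * (2 * ((c / 2 + 1 : ℕ) : ℝ)) :=
        mul_le_mul_of_nonneg_left (by linarith) hδ_pos.le
      have h4 : 0 ≤ δ * (δ * k) := by positivity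
      nlinarith
    have hX : 0 < (n : ℝ) ^ (δ ^ 2 * (k : ℝ) / 2) := Real.rpow_pos_of_pos hn0 _
    have h5 : 1 / 2 ≤ (C.size : ℝ) * (2 * ((n : ℝ) ^ (δ ^ 2 * (k : ℝ) / 2))⁻¹) :=
      h.trans (by gcongr)
    have h6 := mul_le_mul_of_nonneg_right h5 hX.le
    have h7 : (C.size : ℝ) * (2 * ((n : ℝ) ^ (δ ^ 2 * (k : ℝ) / 2))⁻¹) *
        (n : ℝ) ^ (δ ^ 2 * (k : ℝ) / 2) = 2 * C.size := by field_simp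
    linarith
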